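/- **Notation.** Logarithms are to the base $2$ and $-\log 0=\infty$. Let $\mu_n$ be the uniform distribution on $\{-1,1\}^n\times\{-1,1\}^n$ and $\mathrm{tail}(x)=\frac1{\sqrt{2\pi}}\int_x^\infty e^{-u^2/2}\,du$. A communication problem is a partial function $f:\mathcal X\times\mathcal Y\to\mathcal Z\cup\{*\}$ on finite sets, where $f(x,y)=*$ means that $f$ is undefined at $(x,y)$. Let $$\mathrm{ORT}_{b,n}(x,y)=\begin{cases}1,&|\langle x,y\rangle|\le b\sqrt n,\\-1,&\text{otherwise,}\end{cases}\qquad \mathrm{GHD}_n(x,y)=\begin{cases}-1,&\langle x,y\rangle\le-\sqrt n,\\1,&\langle x,y\rangle\ge\sqrt n,\\ *,&\text{otherwise}\end{cases}$$ for $x,y\in\{-1,1\}^n$. For a distribution $\lambda$ on $\mathcal X\times\mathcal Y$ and $z\in\mathcal Z$, a rectangle $S=S_1\times S_2$ is $\varepsilon$-error $z$-monochromatic for $f$ under $\lambda$ if $\lambda(S\setminus(f^{-1}(z)\cup f^{-1}(*)))\le\varepsilon\,\lambda(S)$. The corruption bound $\mathrm{cb}^{z,\lambda}_\varepsilon(f)$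 is $-\log$ of the maximum of $\lambda(S)$ over all such rectangles $S$. The smooth corruption bound $\mathrm{scb}^{z,\lambda}_{\varepsilon,\delta}(f)$ is the maximum of $\mathrm{cb}^{z,\lambda}_\varepsilon(g)$ over all $g:\mathcal X\times\mathcal Y\to\mathcal Z\cup\{*\}$ with $\Pr_{(X,Y)\sim\lambda}[f(X,Y)\ne g(X,Y)]\le\delta$. The information complexity $\mathrm{IC}^\lambda_\varepsilon(f)$ is the infimum of $I(XY:P(X,Y)\mid R)$, where $(X,Y)\sim\lambda$, over all two-party protocols $P$ with private coins and public randomness $R$, with transcript $P(X,Y)$, for which the probability (over the input and all coins) that $f(X,Y)\ne *$ and the output differs from $f(X,Y)$ is at most $\varepsilon$. **Theorem.** There is an absolute constant $c>0$ such that for every real $b\ge100$ there are $C$ and $n_0$, depending only on $b$, with the following property. Let $n\ge n_0$, let $\mathrm{tail}(1.99b)\le\theta\le 1/1600$, and let $n'$ be $n+\frac12(1.99b-1)\sqrt n$ rounded to an integer, up or down (that is, $n'$ is a non-negative integer with $|n'-(n+\frac12(1.99b-1)\sqrt n)|<1$). Then $$\mathrm{scb}^{1,\mu_n}_{400\theta,\theta}(\mathrm{GHD}_n)\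 \ge\ c\cdot\mathrm{cb}^{1,\mu_{n'}}_{400\theta}(\mathrm{ORT}_{b,n'})-C\sqrt n$$ and $$\mathrm{IC}^{\mu_n}_{\theta}(\mathrm{GHD}_n)\ \ge\ c\cdot\mathrm{cb}^{1,\mu_{n'}}_{400\theta}(\mathrm{ORT}_{b,n'})-C\sqrt n .$$ -/

import Mathlib

noncomputable section

namespace InfoCorruption

/-! ### Probabilities on finite sets -/

/-- The probability of the event `E` under the distribution `ρ` on a finite set. -/
def prob {α : Type} [Fintype α] (ρ : PMF α) (E : Set α) : ℝ :=
  ∑ a, E.indicator (fun a => (ρ a).toReal) a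

/-- Mutual information, in bits, of the two coordinates of a pair with values in `S × T` and joint
law `p`: the sum of `p(a,b) log₂ (p(a,b) / (p(a) p(b)))`. Terms with `p(a,b) = 0` vanish. -/
def mutualInfo {α β : Type} (S : Finset α) (T : Finset β) (p : α → β → ℝ) : ℝ :=
  ∑ a ∈ S, ∑ b ∈ T,
    p a b * Real.logb 2 (p a b / ((∑ b' ∈ T, p a b') * ∑ a' ∈ S, p a' b))

/-- The upper tail of the standard normal distribution. -/
def tail (x : ℝ) : ℝ :=
  1 / √(2 * Real.pi) * ∫ u in Set.Ioi x, Real.exp (-u ^ 2 / 2)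

/-! ### Corruption bounds

A communication problem is a partial function `X × Y → Z ∪ {*}`, written `X × Y → Option Z`, with
`none` in the role of `*`. Logarithms are to the base 2. -/

section Corruption

variable {X Y Z : Type} [Fintype X] [Fintype Y]

/-- `S` is `ε`-error `z`-monochromatic for `f` under `ρ`. -/
def IsErrMono (ε : ℝ) (z : Z) (ρ : PMF (X × Y)) (f : X × Y → Option Z) (S : Set (X × Y)) : Prop :=
  prob ρ (S \ (f ⁻¹' {some z} ∪ f ⁻¹' {none})) ≤ ε * prob ρ S

/-- The largest probability of an `ε`-error `z`-monochromatic rectangle `A × B`. The supremum is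
over finitely many rectangles, among them the empty one. -/
def errMono (ε : ℝ) (z : Z) (ρ : PMF (X × Y)) (f : X × Y → Option Z) : ℝ :=
  sSup {p : ℝ | ∃ (A : Set X) (B : Set Y), IsErrMono ε z ρ f (A ×ˢ B) ∧ p = prob ρ (A ×ˢ B)}

open Classical in
/-- The corruption bound `-log₂ (errMono ε z ρ f)`, where `-log₂ 0 = ∞`. -/
def cb (z : Z) (ρ : PMF (X × Y)) (ε : ℝ) (f : X × Y → Option Z) : EReal :=
  if errMono ε z ρ f = 0 then ⊤ else ((-Real.logb 2 (errMono ε z ρ f) : ℝ) : EReal)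

/-- The smooth corruption bound with error parameter `ε` and perturbation parameter `δ`: the
maximum of the corruption bounds of all partial functions `g` that differ from `f` with probability
at most `δ`. -/
def scb (z : Z) (ρ : PMF (X × Y)) (ε δ : ℝ) (f : X × Y → Option Z) : EReal :=
  ⨆ (g : X × Y → Option Z) (_ : prob ρ {w | f w ≠ g w} ≤ δ), cb z ρ ε g

end Corruption

/-! ### Protocols and information complexity -/

/-- A private-coin two-party protocol, as a finite tree. At a node of Alice (Bob) the next bit of the
transcript is sent by Alice (Bob), who uses fresh private coins to make it `true` with a probability
that depends on the own input and on the node, that is, on the transcript so far. A leaf carries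
the output on which the players agree. -/
inductive PrivateProtocol (X Y Z : Type) : Type
  | output (z : Z) : PrivateProtocol X Y Z
  | alice (p : X → unitInterval) (next : Bool → PrivateProtocol X Y Z) : PrivateProtocol X Y Z
  | bob (p : Y → unitInterval) (next : Bool → PrivateProtocol X Y Z) : PrivateProtocol X Y Z

/-- The probability of the bit `b` if `true` has probability `p`. -/
def bitProb (p : unitInterval) (b : Bool) : ℝ :=
  if b then (p : ℝ) else 1 - (p : ℝ)

namespace PrivateProtocol

variable {X Y Z : Type}

/-- The transcripts of a protocol: the bit sequences that lead from the root to a leaf. -/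
def transcripts : PrivateProtocol X Y Z → Finset (List Bool)
  | output _ => {[]}
  | alice _ next => Finset.univ.biUnion fun b => ((next b).transcripts).image (List.cons b)
  | bob _ next => Finset.univ.biUnion fun b => ((next b).transcripts).image (List.cons b)

/-- The output that corresponds to a transcript (`none` if the sequence does not lead to a leaf). -/
def out : PrivateProtocol X Y Z → List Bool → Option Z
  | output z, [] => some z
  | output _, _ :: _ => none
  | alice _ _, [] => none
  | alice _ next, b :: t => (next b).out t
  | bob _ _, [] => none
  | bob _ next, b :: t => (next b).out t

/-- The probability, over the private coins, that the transcript on the input `w = (x, y)` is the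
given one. -/
def transcriptProb (w : X × Y) : PrivateProtocol X Y Z → List Bool → ℝ
  | output _, [] => 1
  | output _, _ :: _ => 0
  | alice _ _, [] => 0
  | alice p next, b :: t => bitProb (p w.1) b * (next b).transcriptProb w t
  | bob _ _, [] => 0
  | bob p next, b :: t => bitProb (p w.2) b * (next b).transcriptProb w t

/-- The probability, over `(X, Y) ∼ ρ` and the private coins, that `f (X, Y)` is defined and the
output is not `f (X, Y)`. -/
def error [Fintype X] [Fintype Y] (P : PrivateProtocol X Y Z) (ρ : PMF (X × Y))
    (f : X × Y → Option Z) : ℝ :=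
  ∑ w : X × Y, ∑ t ∈ P.transcripts,
    {t | f w ≠ none ∧ P.out t ≠ f w}.indicator
      (fun t => (ρ w).toReal * P.transcriptProb w t) t

/-- The mutual information, in bits, of the input `(X, Y) ∼ ρ` and the transcript. -/
def icost [Fintype X] [Fintype Y] (P : PrivateProtocol X Y Z) (ρ : PMF (X × Y)) : ℝ :=
  mutualInfo Finset.univ P.transcripts fun w t => (ρ w).toReal * P.transcriptProb w t

end PrivateProtocol

/-- A protocol with public and private coins: a public random outcome `r` of law `ν` is drawn,
independently of the input, and the players run the private-coin protocol `run r`. -/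
structure Protocol (X Y Z : Type) where
  R : Type
  ν : PMF R
  run : R → PrivateProtocol X Y Z

namespace Protocol

variable {X Y Z : Type} [Fintype X] [Fintype Y]

/-- The error probability over the input, the public and the private coins. The sum is an average
of numbers in `[0, 1]`. -/
def error (P : Protocol X Y Z) (ρ : PMF (X × Y)) (f : X × Y → Option Z) : ℝ :=
  ∑' r, (P.ν r).toReal * (P.run r).error ρ f

/-- The information cost `I(XY : P(X,Y) | R)`, with `R` the public randomness. The sum is an average
of numbers between `0` and `log₂ |X × Y|`. -/
def icost (P : Protocol X Y Z) (ρ : PMF (X × Y)) : ℝ :=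
  ∑' r, (P.ν r).toReal * (P.run r).icost ρ

end Protocol

/-- The `ε`-error information complexity of `f` under `ρ`. -/
def IC {X Y Z : Type} [Fintype X] [Fintype Y] (ρ : PMF (X × Y)) (ε : ℝ)
    (f : X × Y → Option Z) : EReal :=
  ⨅ (P : Protocol X Y Z) (_ : P.error ρ f ≤ ε), ((P.icost ρ : ℝ) : EReal)

/-! ### Orthogonality and Gap-Hamming

The units of `ℤ` serve as the set `{-1, 1}`. -/

/-- The cube `{-1, 1}ⁿ`. -/
abbrev Cube (n : ℕ) : Type := Fin n → ℤˣ

/-- The uniform distribution on `{-1, 1}ⁿ × {-1, 1}ⁿ`. -/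
def unif (n : ℕ) : PMF (Cube n × Cube n) := PMF.uniformOfFintype (Cube n × Cube n)

/-- The inner product of `x` and `y`. -/
def ip {n : ℕ} (x y : Cube n) : ℝ := ∑ i, ((x i : ℤ) : ℝ) * ((y i : ℤ) : ℝ)

open Classical in
/-- The approximate orthogonality problem. -/
def ORT (b : ℝ) (n : ℕ) (w : Cube n × Cube n) : Option ℤˣ :=
  if |ip w.1 w.2| ≤ b * √(n : ℝ) then some 1 else some (-1)

open Classical in
/-- The Gap-Hamming problem. -/
def GHD (n : ℕ) (w : Cube n × Cube n) : Option ℤˣ :=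
  if ip w.1 w.2 ≤ -√(n : ℝ) then some (-1)
  else if √(n : ℝ) ≤ ip w.1 w.2 then some 1
  else none

end InfoCorruption

end

/-! Both bounds pass through one perturbation `g` of Gap-Hamming, `cappedGHD`: where the inner
product exceeds `1.99 b √n + 4` the value is reset to `-1`. By a Gaussian tail bound without error
term (`prob_lt_ip_le_tail`) this changes the function with probability at most `tail (1.99 b) ≤ θ`,
so `g` is admissible for the smooth corruption bound.

Wherever `g` is not `-1`, the inner product lies in `(-√n, 1.99 b √n + 4]`, an interval with
midpoint close to `k = n' - n` and half-width slightly below `b √n`. Appending `k` coordinates with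
product `-1` subtracts `k` from the inner product, hence turns such inputs into `1`-inputs of
orthogonality. Padding sends rectangles to rectangles and divides all probabilities by `4 ^ k`, so
relative errors survive and the corruption bound of `g` is at least that of orthogonality minus `2k
= O(b √n)` (`errMono_le_errMono_ORT`). This gives the first bound.

For the second, corruption of `g` must bound information from below (`rpow_le_errMono`). In a
protocol for Gap-Hamming with error `θ`, averaging finds a transcript with output `1` under which
the conditional error against `g` is `O(θ)` and the posterior of the input has relative entropy `D`,
at most a constant times information cost plus one (`exists_transcript`). The prior is a product and
a transcript probability factors as `a x * b y`, so the posterior density is a product `h x * k y`.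
Small entropy allows both factors to be cut at `2 ^ (4 (D + 1))` with little loss of mass. The
excess of error over `ε` times mass is bilinear in the bounded factors, so it is already negative
enough at a pair of indicators, that is, on a rectangle of probability `2 ^ (-O(D + 1))`
(`exists_rectangle_of_bounded`). -/

namespace InfoCorruption

open Real Finset

/-! ### Bounds for binomial coefficients -/

/-- First term of the series `log (1 + x) - log (1 - x) = 2 (x + x³/3 + ...)`, whose terms are
nonnegative. -/
theorem one_sub_le_one_add_mul_exp {x : ℝ} (h0 : 0 ≤ x) (h1 : x < 1) :
    1 - x ≤ (1 + x) * exp (-(2 * x)) := by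
  have hs := hasSum_log_sub_log_of_abs_lt_one (x := x) (by rw [abs_of_nonneg h0]; exact h1)
  have h : 2 * x ≤ log (1 + x) - log (1 - x) := by
    have := sum_le_hasSum {0} (fun i _ => by positivity) hs
    simpa using this
  have hp : 0 < 1 - x := by linarith
  have hq : 0 < 1 + x := by linarith
  rw [← exp_log hq, ← exp_add]
  calc 1 - x = exp (log (1 - x)) := (exp_log hp).symm
    _ ≤ _ := exp_le_exp.2 (by linarith)

/-- Rearrangement of the lower bound `Wallis.le_W` for the Wallis product. -/
theorem centralBinom_le {m : ℕ} (hm : 1 ≤ m) :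
    (m.centralBinom : ℝ) ≤ 4 ^ m / √(π * m) := by
  have hW := Wallis.le_W m
  rw [Wallis.W_eq_factorial_ratio] at hW
  have hc : (m.centralBinom : ℝ) = (2 * m).factorial / (m.factorial : ℝ) ^ 2 := by
    rw [Nat.centralBinom_eq_two_mul_choose, Nat.cast_choose ℝ (by omega),
      show 2 * m - m = m by omega, sq]
  have hf : (0 : ℝ) < m.factorial := by exact_mod_cast m.factorial_pos
  have hg : (0 : ℝ) < (2 * m).factorial := by exact_mod_cast (2 * m).factorial_pos
  have hm' : (1 : ℝ) ≤ m := by exact_mod_cast hm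
  have hpi := pi_pos
  rw [le_div_iff₀ (by positivity)]
  refine abs_le_of_sq_le_sq' ?_ (by positivity) |>.2
  rw [mul_pow, sq_sqrt (by positivity), hc, div_pow, div_mul_eq_mul_div,
    div_le_iff₀ (by positivity)]
  rw [le_div_iff₀ (by positivity)] at hW
  have e1 : ((2 : ℝ) ^ (4 * m)) = (4 ^ m) ^ 2 := by
    rw [← pow_mul, show (4 : ℝ) = 2 ^ 2 by norm_num, ← pow_mul]; ring_nf
  rw [e1] at hW
  rw [← pow_mul (m.factorial : ℝ) 2 2]
  refine le_trans ?_ hW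
  have : π * m ≤ ((2 : ℝ) * m + 1) / (2 * m + 2) * (π / 2) * (2 * m + 1) := by
    rw [div_mul_eq_mul_div, div_mul_eq_mul_div, le_div_iff₀ (by positivity)]
    nlinarith
  calc ((2 * m).factorial : ℝ) ^ 2 * (π * m) ≤ (2 * m).factorial ^ 2 * _ :=
        mul_le_mul_of_nonneg_left this (by positivity)
    _ = _ := by ring

theorem choose_le_two_pow_mul_sqrt {n : ℕ} (hn : 1 ≤ n) (j : ℕ) :
    (n.choose j : ℝ) ≤ 2 ^ n * √(2 / (π * n)) := by
  have hpi := pi_pos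
  have hn' : (1 : ℝ) ≤ n := by exact_mod_cast hn
  have hle : (n.choose j : ℝ) ≤ n.choose (n / 2) := by exact_mod_cast Nat.choose_le_middle j n
  refine hle.trans ?_
  obtain ⟨m, rfl | rfl⟩ := n.even_or_odd'
  · have hm : 1 ≤ m := by omega
    have hm' : (1 : ℝ) ≤ m := by exact_mod_cast hm
    have := centralBinom_le hm
    rw [Nat.mul_div_cancel_left m two_pos, ← Nat.centralBinom_eq_two_mul_choose, pow_mul]
    refine this.trans (le_of_eq ?_)
    rw [div_eq_mul_inv, ← sqrt_inv]
    push_cast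
    congr 2
    · norm_num
    · field_simp
  -- For odd `n`, the middle coefficient is half the central one of row `n + 1`.
  · have h1 := centralBinom_le (m := m + 1) (by omega)
    rw [show (2 * m + 1) / 2 = m by omega]
    have h2 : ((m + 1).centralBinom : ℝ) = 2 * (2 * m + 1).choose m := by
      rw [Nat.centralBinom_eq_two_mul_choose, show 2 * (m + 1) = (2 * m + 1) + 1 by ring,
        Nat.choose_succ_succ, Nat.choose_symm_half]
      push_cast; ring
    rw [h2, div_eq_mul_inv, ← sqrt_inv] at h1
    have h3 : √(π * ((m + 1 : ℕ) : ℝ))⁻¹ ≤ √(2 / (π * ((2 * m + 1 : ℕ) : ℝ))) := by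
      apply sqrt_le_sqrt
      rw [inv_eq_one_div]
      push_cast
      rw [div_le_div_iff₀ (by positivity) (by positivity)]
      nlinarith
    have h4 : (4 : ℝ) ^ (m + 1) = 2 * 2 ^ (2 * m + 1) := by
      rw [pow_succ, pow_succ, pow_mul]; norm_num; ring
    rw [h4] at h1
    have : (0 : ℝ) < 2 ^ (2 * m + 1) := by positivity
    nlinarith

/-- A Gaussian bound for the upper half of a row of Pascal's triangle. -/
theorem choose_mul_exp_le {n j : ℕ} (hn : 1 ≤ n) (hj : n ≤ 2 * j) (hjn : j ≤ n) :
    (n.choose j : ℝ) * exp ((2 * j - n : ℝ) ^ 2 / (2 * (n + 1))) ≤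
      2 ^ n * √(2 / (π * n)) * exp (1 / (2 * (n + 1))) := by
  have hn0 : (0 : ℝ) < n + 1 := by positivity
  have hj0 : (n + 1) / 2 ≤ j := by omega
  clear hj
  induction j, hj0 using Nat.le_induction with
  | base =>
    refine mul_le_mul (choose_le_two_pow_mul_sqrt hn _) ?_ (exp_pos _).le (by positivity)
    refine exp_le_exp.2 (div_le_div_of_nonneg_right ?_ (by positivity))
    have h1 : n ≤ 2 * ((n + 1) / 2) := by omega
    have h2 : 2 * ((n + 1) / 2) ≤ n + 1 := by omega
    have h1' : (n : ℝ) ≤ 2 * ((n + 1) / 2 : ℕ) := by exact_mod_cast h1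
    have h2' : 2 * (((n + 1) / 2 : ℕ) : ℝ) ≤ n + 1 := by exact_mod_cast h2
    nlinarith
  | succ j hj ih =>
    refine le_trans ?_ (ih (by omega))
    have hk : n ≤ 2 * j := by omega
    have hk' : (n : ℝ) ≤ 2 * j := by exact_mod_cast hk
    have hjn' : (j : ℝ) + 1 ≤ n := by exact_mod_cast hjn
    have hrec : (n.choose (j + 1) : ℝ) * (j + 1) = n.choose j * (n - j) := by
      have := n.choose_succ_right_eq j
      rw [← Nat.cast_sub (by omega : j ≤ n)]
      exact_mod_cast this
    -- With this `x`, the ratio of consecutive coefficients is `(1 - x) / (1 + x) ≤ exp (-2x)`,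
    -- while the Gaussian factor grows by exactly `exp (2x)`; so the product does not increase away
    -- from the middle.
    set x : ℝ := (2 * j - n + 1) / (n + 1) with hx
    have hx0 : 0 ≤ x := div_nonneg (by linarith) hn0.le
    have hx1 : x < 1 := by rw [hx, div_lt_one hn0]; linarith
    have hx2 := one_sub_le_one_add_mul_exp hx0 hx1
    have e1 : 1 - x = 2 * (n - j) / (n + 1) := by rw [hx]; field_simp; ring
    have e2 : 1 + x = 2 * (j + 1) / (n + 1) := by rw [hx]; field_simp; ring
    have hratio : (n : ℝ) - j ≤ (j + 1) * exp (-(2 * x)) := by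
      rw [e1, e2, div_mul_eq_mul_div, div_le_div_iff_of_pos_right hn0] at hx2
      linarith
    have hexp : exp ((2 * ((j + 1 : ℕ) : ℝ) - n) ^ 2 / (2 * (n + 1))) =
        exp ((2 * j - n : ℝ) ^ 2 / (2 * (n + 1))) * exp (2 * x) := by
      rw [← exp_add]; congr 1; rw [hx]; push_cast; field_simp; ring
    have hc : (n.choose (j + 1) : ℝ) ≤ n.choose j * exp (-(2 * x)) := by
      have hj1 : (0 : ℝ) < j + 1 := by positivity
      refine le_of_mul_le_mul_right ?_ hj1
      rw [hrec]
      nlinarith [mul_le_mul_of_nonneg_left hratio (Nat.cast_nonneg (α := ℝ) (n.choose j))]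
    rw [hexp]
    calc _ ≤ n.choose j * exp (-(2 * x)) *
          (exp ((2 * j - n : ℝ) ^ 2 / (2 * (n + 1))) * exp (2 * x)) :=
          mul_le_mul_of_nonneg_right hc (by positivity)
      _ = _ := by
          rw [exp_neg]; field_simp

/-! ### The normal tail -/

theorem integrable_exp_neg_sq_half :
    MeasureTheory.Integrable (fun u : ℝ => exp (-u ^ 2 / 2)) := by
  have := integrable_exp_neg_mul_sq (b := 1 / 2) (by norm_num)
  refine this.congr (Filter.Eventually.of_forall fun u => ?_)
  simp only; ring_nf

theorem tail_sub_tail {x y : ℝ} (h : x ≤ y) :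
    tail x - tail y = 1 / √(2 * π) * ∫ u in x..y, exp (-u ^ 2 / 2) := by
  have hi := integrable_exp_neg_sq_half
  rw [tail, tail, ← mul_sub, intervalIntegral.integral_Ioi_sub_Ioi hi.integrableOn h]

theorem tail_nonneg (x : ℝ) : 0 ≤ tail x :=
  mul_nonneg (by positivity) (MeasureTheory.integral_nonneg fun _ => (exp_pos _).le)

theorem tail_sub_tail_ge {x y : ℝ} (h : x ≤ y) (hx : 0 ≤ x) :
    1 / √(2 * π) * ((y - x) * exp (-y ^ 2 / 2)) ≤ tail x - tail y := by
  rw [tail_sub_tail h]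
  refine mul_le_mul_of_nonneg_left ?_ (by positivity)
  have hi := integrable_exp_neg_sq_half
  have := intervalIntegral.integral_mono_on (f := fun _ => exp (-y ^ 2 / 2))
    (g := fun u => exp (-u ^ 2 / 2)) h (by simp) hi.intervalIntegrable
    (fun u hu => exp_le_exp.2 (by nlinarith [hu.1, hu.2]))
  simpa using this

theorem tail_antitone {x y : ℝ} (h : x ≤ y) : tail y ≤ tail x := by
  have := tail_sub_tail h
  have h2 : 0 ≤ 1 / √(2 * π) * ∫ u in x..y, exp (-u ^ 2 / 2) :=
    mul_nonneg (by positivity) (intervalIntegral.integral_nonneg h fun _ _ => (exp_pos _).le)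
  linarith

theorem tail_pos {x : ℝ} (hx : 0 ≤ x) : 0 < tail x := by
  have := tail_sub_tail_ge (by linarith : x ≤ x + 1) hx
  have h0 := tail_nonneg (x + 1)
  have : 0 < 1 / √(2 * π) * ((x + 1 - x) * exp (-(x + 1) ^ 2 / 2)) := by
    have := pi_pos
    have : (0 : ℝ) < x + 1 - x := by linarith
    positivity
  linarith

/-- Each binomial mass is compared with the normal mass of an interval of length `2 / √n`, moved
towards the origin. These intervals are adjacent, so the bounds telescope to a single tail. -/
theorem choose_le_tail_sub_tail {n j : ℕ} (hj : n + 4 ≤ 2 * j) (hjn : j ≤ n) :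
    (n.choose j : ℝ) / 2 ^ n ≤
      tail ((2 * j - n - 4) / √n) - tail ((2 * (j + 1 : ℕ) - n - 4) / √n) := by
  have hn : 1 ≤ n := by omega
  have hn' : (1 : ℝ) ≤ n := by exact_mod_cast hn
  have hs : 0 < √(n : ℝ) := sqrt_pos.2 (by linarith)
  have hjn' : (j : ℝ) ≤ n := by exact_mod_cast hjn
  have hj' : (n : ℝ) + 4 ≤ 2 * j := by exact_mod_cast hj
  have hpi := pi_pos
  have hb := choose_mul_exp_le hn (by omega : n ≤ 2 * j) hjn
  refine le_trans ?_ (tail_sub_tail_ge (by push_cast; gcongr; linarith)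
    (div_nonneg (by linarith) hs.le))
  rw [← le_div_iff₀ (exp_pos _), mul_div_assoc, ← exp_sub] at hb
  rw [div_le_iff₀ (by positivity)]
  refine hb.trans ?_
  have e1 : √(2 / (π * n)) = 1 / √(2 * π) * (2 / √n) := by
    rw [← sqrt_sq (by positivity : 0 ≤ 1 / √(2 * π) * (2 / √n))]
    congr 1
    rw [mul_pow, div_pow, div_pow, sq_sqrt (by positivity), sq_sqrt (by positivity)]
    field_simp
  have e2 : (2 * ((j + 1 : ℕ) : ℝ) - n - 4) / √n - (2 * j - n - 4) / √n = 2 / √n := by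
    push_cast; rw [← sub_div]; ring_nf
  rw [e1, e2]
  -- The shift by `4` leaves the right endpoint at `(k - 2) / √n` with `k = 2j - n`. Replacing `k`
  -- by `k - 2` pays for `n + 1` in place of `n` in the variance and for the factor `exp (1 / (2 (n
  -- + 1)))`.
  have e3 : exp (1 / (2 * (n + 1)) - (2 * j - n) ^ 2 / (2 * (n + 1))) ≤
      exp (-((2 * ((j + 1 : ℕ) : ℝ) - n - 4) / √n) ^ 2 / 2) := by
    apply exp_le_exp.2
    rw [div_pow, sq_sqrt (by positivity), ← sub_div, ← neg_div, div_div,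
      div_le_div_iff₀ (by positivity) (by positivity)]
    push_cast
    obtain ⟨k, hk⟩ : ∃ k : ℝ, k = 2 * j - n := ⟨_, rfl⟩
    have h1 : 4 ≤ k := by linarith
    have h2 : k ≤ n := by linarith
    rw [show 2 * ((j : ℝ) + 1) - n - 4 = k - 2 by rw [hk]; ring, ← hk]
    nlinarith [mul_le_mul h2 h1 (by norm_num) (by positivity), mul_nonneg (by linarith : 0 ≤ k - 4)
      (by linarith : (0 : ℝ) ≤ n), mul_nonneg (by linarith : 0 ≤ k - 4) (by linarith : 0 ≤ n - k)]
  calc _ ≤ 2 ^ n * (1 / √(2 * π) * (2 / √n)) * _ := mul_le_mul_of_nonneg_left e3 (by positivity)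
    _ = _ := by ring

theorem sum_choose_le_tail {n J : ℕ} (hJ : n + 4 ≤ 2 * J) (hJn : J ≤ n + 1) :
    ∑ j ∈ Ico J (n + 1), (n.choose j : ℝ) / 2 ^ n ≤ tail ((2 * J - n - 4) / √n) := by
  have h1 : ∑ j ∈ Ico J (n + 1), (n.choose j : ℝ) / 2 ^ n ≤
      ∑ j ∈ Ico J (n + 1), (tail ((2 * j - n - 4) / √n) -
        tail ((2 * (j + 1 : ℕ) - n - 4) / √n)) := by
    refine sum_le_sum fun j hj => ?_
    rw [mem_Ico] at hj
    exact choose_le_tail_sub_tail (by omega) (by omega)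
  have h2 := sum_Ico_sub (fun j : ℕ => -tail ((2 * j - n - 4) / √n)) hJn
  simp only [neg_sub_neg] at h2
  rw [h2] at h1
  linarith [tail_nonneg ((2 * (n + 1 : ℕ) - n - 4) / √n)]

/-! ### The law of the inner product -/

section Prob

variable {α : Type} [Fintype α] (ρ : PMF α)

theorem prob_mono {E F : Set α} (h : E ⊆ F) : prob ρ E ≤ prob ρ F :=
  sum_le_sum fun _ _ => Set.indicator_le_indicator_of_subset h
    (fun _ => ENNReal.toReal_nonneg) _

theorem prob_nonneg (E : Set α) : 0 ≤ prob ρ E :=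
  sum_nonneg fun _ _ => Set.indicator_nonneg (fun _ _ => ENNReal.toReal_nonneg) _

theorem sum_toReal : ∑ a, (ρ a).toReal = 1 := by
  rw [← ENNReal.toReal_sum fun a _ => ρ.apply_ne_top a, ← tsum_fintype (L := .unconditional _),
    ρ.tsum_coe, ENNReal.toReal_one]

theorem prob_univ : prob ρ Set.univ = 1 := by
  simp [prob, sum_toReal]

theorem prob_le_one (E : Set α) : prob ρ E ≤ 1 :=
  (prob_mono ρ (Set.subset_univ E)).trans_eq (prob_univ ρ)

theorem prob_union_le (E F : Set α) : prob ρ (E ∪ F) ≤ prob ρ E + prob ρ F := by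
  rw [prob, prob, prob, ← sum_add_distrib]
  refine sum_le_sum fun a _ => ?_
  have : 0 ≤ (ρ a).toReal := ENNReal.toReal_nonneg
  by_cases h1 : a ∈ E <;> by_cases h2 : a ∈ F <;> simp [h1, h2, this]

theorem prob_eq_ncard_div [Nonempty α] (E : Set α) :
    prob (PMF.uniformOfFintype α) E = E.ncard / Fintype.card α := by
  classical
  rw [prob, Set.ncard_eq_toFinset_card', ← Set.filter_mem_univ_eq_toFinset, card_filter,
    Nat.cast_sum, sum_div]
  refine sum_congr rfl fun a _ => ?_
  by_cases h : a ∈ E <;> simp [h]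

end Prob

theorem card_cube (n : ℕ) : Fintype.card (Cube n) = 2 ^ n := by
  simp [Cube, Fintype.card_units_int]

theorem sum_cube (n : ℕ) (F : ℝ → ℝ) :
    ∑ z : Cube n, F (∑ i, ((z i : ℤ) : ℝ)) =
      ∑ j ∈ range (n + 1), (n.choose j : ℝ) * F (2 * j - n) := by
  classical
  have h := sum_powerset_apply_card (fun j : ℕ => F (2 * j - n)) (x := (univ : Finset (Fin n)))
  simp only [powerset_univ, card_univ, Fintype.card_fin, nsmul_eq_mul] at h
  rw [← h]
  refine sum_bij' (fun z _ => univ.filter fun i => z i = 1)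
    (fun s _ i => if i ∈ s then 1 else -1) (by simp) (by simp) ?_ ?_ ?_
  · intro z _
    funext i
    rcases Int.units_eq_one_or (z i) with h | h <;> simp [h]
  · intro s _
    ext i
    by_cases h : i ∈ s <;> simp [h]
  · intro z _
    congr 1
    have e : ∀ i, ((z i : ℤ) : ℝ) = 2 * (if z i = 1 then 1 else 0) - 1 := by
      intro i
      rcases Int.units_eq_one_or (z i) with h | h <;> (simp [h]; try norm_num)
    simp only [e, sum_sub_distrib, ← mul_sum, sum_boole]
    simp

/-- For fixed `x`, multiplication by `x` permutes the cube, so the inner product is distributed as a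
sum of independent signs. -/
theorem sum_cube_ip (n : ℕ) (F : ℝ → ℝ) :
    ∑ w : Cube n × Cube n, F (ip w.1 w.2) =
      2 ^ n * ∑ j ∈ range (n + 1), (n.choose j : ℝ) * F (2 * j - n) := by
  rw [Fintype.sum_prod_type]
  have h : ∀ x : Cube n, ∑ y : Cube n, F (ip x y) =
      ∑ j ∈ range (n + 1), (n.choose j : ℝ) * F (2 * j - n) := by
    intro x
    rw [← sum_cube]
    refine Fintype.sum_equiv (Equiv.mulLeft x) _ _ fun y => ?_
    simp [ip]
  simp [h]

open Classical in
theorem prob_ip (n : ℕ) (S : Set ℝ) :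
    prob (unif n) {w | ip w.1 w.2 ∈ S} =
      ∑ j ∈ range (n + 1), if (2 * j - n : ℝ) ∈ S then (n.choose j : ℝ) / 2 ^ n else 0 := by
  have h := sum_cube_ip n (fun t => if t ∈ S then 1 else 0)
  have e : prob (unif n) {w | ip w.1 w.2 ∈ S} =
      (∑ w : Cube n × Cube n, if ip w.1 w.2 ∈ S then (1 : ℝ) else 0) / (2 ^ n * 2 ^ n) := by
    rw [prob, sum_div]
    refine sum_congr rfl fun w _ => ?_
    by_cases hw : ip w.1 w.2 ∈ S <;>
      simp [hw, unif]
  rw [e, h, mul_sum, sum_div]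
  refine sum_congr rfl fun j _ => ?_
  split_ifs <;> simp [field]

theorem prob_lt_ip_le_tail {n : ℕ} {t : ℝ} (ht : 0 ≤ t) :
    prob (unif n) {w | t * √n + 4 < ip w.1 w.2} ≤ tail t := by
  classical
  rw [show {w : Cube n × Cube n | t * √n + 4 < ip w.1 w.2} =
    {w | ip w.1 w.2 ∈ Set.Ioi (t * √n + 4)} from rfl, prob_ip]
  obtain ⟨S, hS⟩ : ∃ S : Set ℝ, S = Set.Ioi (t * √n + 4) := ⟨_, rfl⟩
  rw [← hS, ← sum_filter]
  rcases (filter (fun j : ℕ => (2 * j - n : ℝ) ∈ S) (range (n + 1))).eq_empty_or_nonempty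
    with h | h
  · rw [h, sum_empty]; exact tail_nonneg t
  · set J := (filter (fun j : ℕ => (2 * j - n : ℝ) ∈ S) (range (n + 1))).min' h with hJdef
    have hJ := min'_mem _ h
    rw [← hJdef, mem_filter, mem_range, hS, Set.mem_Ioi] at hJ
    have hs : 0 ≤ t * √n := by positivity
    have hJ4 : n + 4 ≤ 2 * J := by
      have : (n : ℝ) + 4 ≤ 2 * J := by linarith [hJ.2]
      exact_mod_cast this
    have hn : (0 : ℝ) < n := by
      have : 0 < n := by omega
      exact_mod_cast this
    refine le_trans (sum_le_sum_of_subset_of_nonneg (t := Ico J (n + 1)) ?_ ?_)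
      ((sum_choose_le_tail hJ4 (by omega)).trans (tail_antitone ?_))
    · intro j hj
      have := min'_le _ j hj
      rw [mem_filter, mem_range] at hj
      exact mem_Ico.2 ⟨this, hj.1⟩
    · intros; positivity
    · rw [le_div_iff₀ (sqrt_pos.2 hn)]
      linarith [hJ.2]

/-- At most `√n + 1` values are possible, each of probability at most `√(2 / (π n)) ≤ 0.8 / √n`. -/
theorem prob_abs_ip_lt_sqrt_le {n : ℕ} (hn : 100 ≤ n) :
    prob (unif n) {w | |ip w.1 w.2| < √n} ≤ 9 / 10 := by
  classical
  have hn' : (100 : ℝ) ≤ n := by exact_mod_cast hn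
  have hs : 10 ≤ √(n : ℝ) := le_sqrt_of_sq_le (by linarith)
  have hss := sq_sqrt (by linarith : (0 : ℝ) ≤ n)
  rw [show {w : Cube n × Cube n | |ip w.1 w.2| < √n} =
    {w | ip w.1 w.2 ∈ {s | |s| < √n}} from rfl, prob_ip, ← sum_filter]
  simp only [Set.mem_ofPred_eq]
  set A := filter (fun j : ℕ => |2 * (j : ℝ) - n| < √n) (range (n + 1))
  have hp : √(2 / (π * n)) ≤ 8 / 10 / √n := by
    rw [sqrt_le_left (by positivity), div_pow, hss, div_le_div_iff₀ (by positivity) (by positivity)]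
    nlinarith [pi_gt_d2]
  have hA : (A.card : ℝ) ≤ √n + 1 := by
    rcases A.eq_empty_or_nonempty with h | h
    · rw [h]; simp; positivity
    · have hsub : A ⊆ Icc (A.min' h) (A.max' h) := fun j hj =>
        mem_Icc.2 ⟨min'_le _ _ hj, le_max' _ _ hj⟩
      have hc := card_le_card hsub
      rw [Nat.card_Icc] at hc
      have hle : A.min' h ≤ A.max' h := min'_le _ _ (max'_mem _ h)
      have h1 := (mem_filter.1 (min'_mem A h)).2
      have h2 := (mem_filter.1 (max'_mem A h)).2
      have hc' : (A.card : ℝ) + A.min' h ≤ A.max' h + 1 := by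
        have : A.card + A.min' h ≤ A.max' h + 1 := by omega
        exact_mod_cast this
      rw [abs_lt] at h1 h2
      linarith [h1.1, h2.2]
  calc ∑ j ∈ A, (n.choose j : ℝ) / 2 ^ n ≤ ∑ j ∈ A, √(2 / (π * n)) := by
        refine sum_le_sum fun j _ => ?_
        rw [div_le_iff₀ (by positivity), mul_comm]
        exact choose_le_two_pow_mul_sqrt (by omega) j
    _ = A.card * √(2 / (π * n)) := by simp
    _ ≤ (√n + 1) * (8 / 10 / √n) := by gcongr
    _ ≤ 9 / 10 := by
        rw [← mul_div_assoc, div_le_iff₀ (by positivity)]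
        linarith

theorem prob_neg_ip (n : ℕ) (t : ℝ) :
    prob (unif n) {w | ip w.1 w.2 ≤ -t} = prob (unif n) {w | t ≤ ip w.1 w.2} := by
  refine Fintype.sum_equiv (Equiv.prodCongr (Equiv.neg _) (Equiv.refl _)) _ _ fun w => ?_
  have : ip (-w.1) w.2 = -ip w.1 w.2 := by simp [ip]
  classical
  simp only [Set.indicator_apply, Set.mem_ofPred_eq, unif, PMF.uniformOfFintype_apply,
    Equiv.prodCongr_apply, Prod.map_fst, Prod.map_snd, Equiv.neg_apply, Equiv.refl_apply, this]
  simp only [le_neg]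

theorem prob_GHD_one_ge {n : ℕ} (hn : 100 ≤ n) :
    1 / 20 ≤ prob (unif n) (GHD n ⁻¹' {some 1}) := by
  have hn' : (100 : ℝ) ≤ n := by exact_mod_cast hn
  have hs : 0 < √(n : ℝ) := sqrt_pos.2 (by linarith)
  have h1 := prob_abs_ip_lt_sqrt_le hn
  have h2 := prob_neg_ip n (√n)
  have h3 : prob (unif n) Set.univ ≤ prob (unif n) ({w | |ip w.1 w.2| < √n} ∪
      ({w | ip w.1 w.2 ≤ -√n} ∪ {w | √n ≤ ip w.1 w.2})) := by
    refine prob_mono _ fun w _ => ?_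
    simp only [Set.mem_union, Set.mem_ofPred_eq, abs_lt]
    by_contra! h
    exact absurd (h.1 h.2.1) (by linarith [h.2.2])
  have h4 := prob_union_le (unif n) {w | |ip w.1 w.2| < √n}
    ({w | ip w.1 w.2 ≤ -√n} ∪ {w | √n ≤ ip w.1 w.2})
  have h5 := prob_union_le (unif n) {w | ip w.1 w.2 ≤ -√n} {w | √n ≤ ip w.1 w.2}
  have h6 : prob (unif n) {w | √n ≤ ip w.1 w.2} ≤ prob (unif n) (GHD n ⁻¹' {some 1}) := by
    refine prob_mono _ fun w hw => ?_
    have hw' : √(n : ℝ) ≤ ip w.1 w.2 := hw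
    simp only [Set.mem_preimage, Set.mem_singleton_iff, GHD]
    rw [if_neg (by linarith), if_pos hw']
  rw [prob_univ] at h3
  linarith

end InfoCorruption

namespace InfoCorruption

open Finset

/-! ### Densities with small entropy -/

theorem sub_le_mul_log_div {x y : ℝ} (hx : 0 ≤ x) (hy : 0 ≤ y) (h : y = 0 → x = 0) :
    x - y ≤ x * Real.log (x / y) := by
  rcases hx.eq_or_lt with rfl | hx'
  · simpa using hy
  have hy' : 0 < y := lt_of_le_of_ne hy fun h0 => hx'.ne' (h h0.symm)
  have h1 := Real.log_le_sub_one_of_pos (div_pos hy' hx')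
  rw [← inv_div, Real.log_inv] at h1
  rw [inv_div] at h1
  have h2 := mul_le_mul_of_nonneg_left h1 hx
  rw [mul_sub, mul_div_cancel₀ _ hx'.ne'] at h2
  linarith

/-- The tangent line of `h log h` at `1 / 2` gives the bound, with room to spare. -/
theorem neg_one_le_mul_logb {h : ℝ} (hh : 0 ≤ h) : -1 ≤ h * Real.logb 2 h := by
  have h1 := sub_le_mul_log_div hh (by norm_num : (0 : ℝ) ≤ 1 / 2) (by norm_num)
  have hl := Real.log_two_gt_d9
  have hu := Real.log_two_lt_d9
  rcases hh.eq_or_lt with rfl | hh'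
  · simp
  rw [Real.log_div hh'.ne' (by norm_num), Real.log_div one_ne_zero two_ne_zero, Real.log_one] at h1
  rw [Real.logb, ← mul_div_assoc, le_div_iff₀ (by linarith)]
  nlinarith

section Density

variable {X : Type} [Fintype X] {u h : X → ℝ}

theorem sum_mul_logb_nonneg (hu : ∀ x, 0 ≤ u x) (hu1 : ∑ x, u x = 1) (hh : ∀ x, 0 ≤ h x)
    (hh1 : ∑ x, u x * h x = 1) : 0 ≤ ∑ x, u x * (h x * Real.logb 2 (h x)) := by
  have hl : 0 < Real.log 2 := Real.log_pos one_lt_two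
  have : ∑ x, u x * ((h x - 1) / Real.log 2) ≤ ∑ x, u x * (h x * Real.logb 2 (h x)) := by
    refine sum_le_sum fun x _ => mul_le_mul_of_nonneg_left ?_ (hu x)
    rw [Real.logb, ← mul_div_assoc]
    have := sub_le_mul_log_div (hh x) zero_le_one (by norm_num)
    rw [div_one] at this
    gcongr
  refine le_trans (le_of_eq ?_) this
  simp only [← mul_div_assoc, ← sum_div, mul_sub, sum_sub_distrib, mul_one, hu1, hh1, sub_self,
    zero_div]

open Classical in
/-- A density of small relative entropy keeps most of its mass when its large values are cut. -/
theorem sum_truncate_ge (hu : ∀ x, 0 ≤ u x) (hu1 : ∑ x, u x = 1) (hh : ∀ x, 0 ≤ h x)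
    (hh1 : ∑ x, u x * h x = 1) {D : ℝ} (hD : 0 ≤ D)
    (hent : ∑ x, u x * (h x * Real.logb 2 (h x)) ≤ D) :
    3 / 4 ≤ ∑ x, u x * (if h x ≤ (2 : ℝ) ^ (4 * (D + 1)) then h x else 0) := by
  set K := 4 * (D + 1) with hK
  -- Markov's inequality for `h log h + 1`, which is nonnegative everywhere and at least `K h` where
  -- `h` is cut; the removed mass is at most `1 / 4`.
  have h1 : K * ∑ x, u x * (if h x ≤ (2 : ℝ) ^ K then 0 else h x) ≤ D + 1 := by
    calc _ ≤ ∑ x, (u x * (h x * Real.logb 2 (h x)) + u x) := by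
          rw [mul_sum]
          refine sum_le_sum fun x _ => ?_
          rw [mul_left_comm, ← mul_add_one]
          refine mul_le_mul_of_nonneg_left ?_ (hu x)
          split_ifs with hx
          · linarith [neg_one_le_mul_logb (hh x)]
          · have hx' := not_le.1 hx
            have hp : 0 < h x := lt_trans (by positivity) hx'
            have : K ≤ Real.logb 2 (h x) :=
              (Real.le_logb_iff_rpow_le one_lt_two hp).2 hx'.le
            nlinarith
      _ ≤ D + 1 := by rw [sum_add_distrib, hu1]; linarith
  have h2 : ∑ x, u x * (if h x ≤ (2 : ℝ) ^ K then h x else 0) +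
      ∑ x, u x * (if h x ≤ (2 : ℝ) ^ K then 0 else h x) = 1 := by
    rw [← sum_add_distrib, ← hh1]
    refine sum_congr rfl fun x _ => ?_
    split_ifs <;> ring
  nlinarith

end Density

/-! ### Rectangles from product densities -/

/-- A linear form on the box `[0, M]^ι` is smallest at the vertex supported on its negative
coefficients. -/
theorem neg_mul_le_sum_mul {ι : Type} [Fintype ι] {w a : ι → ℝ} {c M : ℝ}
    (ha : ∀ i, 0 ≤ a i) (haM : ∀ i, a i ≤ M) (hM : 0 ≤ M)
    (h : ∀ A : Set ι, -c ≤ ∑ i, w i * A.indicator 1 i) : -(c * M) ≤ ∑ i, w i * a i := by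
  have h1 := mul_le_mul_of_nonneg_right (h {i | w i < 0}) hM
  rw [neg_mul] at h1
  refine h1.trans ?_
  rw [sum_mul]
  refine sum_le_sum fun i _ => ?_
  by_cases hi : w i < 0
  · simpa [hi] using mul_le_mul_of_nonpos_left (haM i) hi.le
  · simpa [hi] using mul_nonneg (not_lt.1 hi) (ha i)

section Product

variable {X Y : Type} [Fintype X] [Fintype Y] {ρ : PMF (X × Y)} {u : X → ℝ} {v : Y → ℝ}

theorem prob_inter_prod (hρ : ∀ x y, (ρ (x, y)).toReal = u x * v y) (E : Set (X × Y)) (A : Set X)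
    (B : Set Y) : prob ρ (A ×ˢ B \ Eᶜ) =
      ∑ x, (∑ y, u x * v y * E.indicator 1 (x, y) * B.indicator 1 y) * A.indicator 1 x := by
  classical
  rw [prob, Fintype.sum_prod_type]
  refine sum_congr rfl fun x _ => ?_
  rw [sum_mul]
  refine sum_congr rfl fun y _ => ?_
  simp only [Set.indicator_apply, hρ, Set.mem_sdiff, Set.mem_prod, Set.mem_compl_iff, not_not]
  by_cases h1 : x ∈ A <;> by_cases h2 : y ∈ B <;> by_cases h3 : (x, y) ∈ E <;> simp [h1, h2, h3]

/-- If all rectangles of relative error at most `ε` had mass below `τ`, then error minus `ε` times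
mass would be at least `-ε τ` on every rectangle. Bilinearity would extend this to functions with
values in `[0, M]`, at the cost of a factor `M ^ 2`, against `h`. -/
theorem exists_rectangle_of_bounded
    (hρ : ∀ x y, (ρ (x, y)).toReal = u x * v y) (E : Set (X × Y)) {a : X → ℝ} {b : Y → ℝ}
    {M ε τ : ℝ} (ha : ∀ x, 0 ≤ a x) (haM : ∀ x, a x ≤ M) (hb : ∀ y, 0 ≤ b y) (hbM : ∀ y, b y ≤ M)
    (hM : 0 ≤ M) (hε : 0 ≤ ε)
    (h : ∑ x, ∑ y, u x * v y * E.indicator 1 (x, y) * (a x * b y) <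
      ε * ((∑ x, u x * a x) * (∑ y, v y * b y) - τ * M ^ 2)) :
    ∃ (A : Set X) (B : Set Y), prob ρ (A ×ˢ B \ Eᶜ) ≤ ε * prob ρ (A ×ˢ B) ∧
      τ ≤ prob ρ (A ×ˢ B) := by
  by_contra! hcon
  have hvert : ∀ (A : Set X) (B : Set Y), -(ε * τ) ≤ ∑ x, (∑ y, (u x * v y *
      (E.indicator 1 (x, y) - ε)) * B.indicator 1 y) * A.indicator 1 x := by
    intro A B
    have e1 := prob_inter_prod hρ E A B
    have e2 := prob_inter_prod hρ Set.univ A B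
    rw [Set.compl_univ, Set.sdiff_empty] at e2
    have e3 : ∑ x, (∑ y, (u x * v y * (E.indicator 1 (x, y) - ε)) * B.indicator 1 y) *
        A.indicator 1 x = prob ρ (A ×ˢ B \ Eᶜ) - ε * prob ρ (A ×ˢ B) := by
      rw [e1, e2, mul_sum, ← sum_sub_distrib]
      refine sum_congr rfl fun x _ => ?_
      rw [← mul_assoc, ← sub_mul, mul_sum, ← sum_sub_distrib]
      congr 1
      refine sum_congr rfl fun y _ => ?_
      simp only [Set.indicator_univ, Pi.one_apply]
      ring
    rw [e3]
    have h0 := prob_nonneg ρ (A ×ˢ B \ Eᶜ)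
    by_cases hc : prob ρ (A ×ˢ B \ Eᶜ) ≤ ε * prob ρ (A ×ˢ B)
    · have := mul_le_mul_of_nonneg_left (hcon A B hc).le hε
      linarith
    -- A negative `τ` is excluded by the empty rectangle.
    · have hτ : 0 ≤ ε * τ ∨ ε * τ < 0 := le_or_gt 0 _
      rcases hτ with hτ | hτ
      · linarith
      · have hτ' : τ < 0 := by
          by_contra! h'
          exact absurd (mul_nonneg hε h') (by linarith)
        have h1 := prob_nonneg ρ (A ×ˢ B)
        have h2 := hcon ∅ ∅ (by simp [prob])
        have h3 := prob_nonneg ρ (∅ ×ˢ ∅ : Set (X × Y))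
        linarith
  have h1 : ∀ B : Set Y, -(ε * τ * M) ≤ ∑ y, (∑ x, (u x * v y * (E.indicator 1 (x, y) - ε)) * a x) *
      B.indicator 1 y := by
    intro B
    have := neg_mul_le_sum_mul ha haM hM (fun A => hvert A B)
    refine this.trans (le_of_eq ?_)
    simp only [sum_mul]
    rw [sum_comm]
    exact sum_congr rfl fun y _ => sum_congr rfl fun x _ => by ring
  have h2 := neg_mul_le_sum_mul hb hbM hM h1
  have h3 : ∑ y, (∑ x, (u x * v y * (E.indicator 1 (x, y) - ε)) * a x) * b y =
      ∑ x, ∑ y, u x * v y * E.indicator 1 (x, y) * (a x * b y) -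
        ε * ((∑ x, u x * a x) * (∑ y, v y * b y)) := by
    rw [sum_mul_sum, mul_sum, ← sum_sub_distrib]
    simp only [sum_mul, mul_sum]
    rw [sum_comm]
    refine sum_congr rfl fun x _ => ?_
    rw [← sum_sub_distrib]
    exact sum_congr rfl fun y _ => by ring
  rw [h3] at h2
  nlinarith

/-- A product density of small relative entropy and small error yields a large rectangle of small
error. -/
theorem exists_rectangle_of_density (hu : ∀ x, 0 ≤ u x) (hv : ∀ y, 0 ≤ v y)
    (hu1 : ∑ x, u x = 1) (hv1 : ∑ y, v y = 1)
    (hρ : ∀ x y, (ρ (x, y)).toReal = u x * v y) (E : Set (X × Y)) {h : X → ℝ} {k : Y → ℝ}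
    (hh : ∀ x, 0 ≤ h x) (hk : ∀ y, 0 ≤ k y) (hh1 : ∑ x, u x * h x = 1)
    (hk1 : ∑ y, v y * k y = 1) {D ε : ℝ} (hε : 0 ≤ ε)
    (hent : ∑ x, u x * (h x * Real.logb 2 (h x)) + ∑ y, v y * (k y * Real.logb 2 (k y)) ≤ D)
    (herr : ∑ x, ∑ y, u x * v y * E.indicator 1 (x, y) * (h x * k y) < 5 / 16 * ε) :
    ∃ (A : Set X) (B : Set Y), prob ρ (A ×ˢ B \ Eᶜ) ≤ ε * prob ρ (A ×ˢ B) ∧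
      (2 : ℝ) ^ (-(8 * (D + 1) + 2)) ≤ prob ρ (A ×ˢ B) := by
  classical
  have n1 := sum_mul_logb_nonneg hu hu1 hh hh1
  have n2 := sum_mul_logb_nonneg hv hv1 hk hk1
  have hD : 0 ≤ D := by linarith
  have m1 := sum_truncate_ge hu hu1 hh hh1 hD (by linarith)
  have m2 := sum_truncate_ge hv hv1 hk hk1 hD (by linarith)
  set M : ℝ := (2 : ℝ) ^ (4 * (D + 1)) with hM
  have hM0 : 0 < M := by positivity
  -- The truncated factors have product mass at least `(3/4)² = 9/16`; subtracting `τ M ^ 2 = 1/4`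
  -- leaves the `5/16` of the hypothesis.
  have hτ : (2 : ℝ) ^ (-(8 * (D + 1) + 2)) * M ^ 2 = 1 / 4 := by
    rw [hM, ← Real.rpow_natCast, ← Real.rpow_mul two_pos.le, ← Real.rpow_add two_pos,
      show -(8 * (D + 1) + 2) + 4 * (D + 1) * ((2 : ℕ) : ℝ) = ((-2 : ℤ) : ℝ) by push_cast; ring,
      Real.rpow_intCast]
    norm_num
  refine exists_rectangle_of_bounded hρ E
    (a := fun x => if h x ≤ M then h x else 0) (b := fun y => if k y ≤ M then k y else 0)
    (M := M) ?_ ?_ ?_ ?_ hM0.le hε ?_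
  · intro x; split_ifs
    exacts [hh x, le_rfl]
  · intro x; split_ifs with hx
    exacts [hx, hM0.le]
  · intro y; split_ifs
    exacts [hk y, le_rfl]
  · intro y; split_ifs with hy
    exacts [hy, hM0.le]
  · rw [hτ]
    refine lt_of_le_of_lt ?_ (herr.trans_le ?_)
    · refine sum_le_sum fun x _ => sum_le_sum fun y _ => mul_le_mul_of_nonneg_left ?_ ?_
      · have := mul_nonneg (hh x) (hk y)
        split_ifs <;> simp [this]
      · exact mul_nonneg (mul_nonneg (hu x) (hv y))
          (Set.indicator_nonneg (fun _ _ => zero_le_one) _)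
    · rw [mul_comm]
      refine mul_le_mul_of_nonneg_left ?_ hε
      nlinarith

end Product

/-! ### Transcripts -/

theorem bitProb_nonneg (p : unitInterval) (b : Bool) : 0 ≤ bitProb p b := by
  cases b
  · simpa [bitProb] using p.2.2
  · simpa [bitProb] using p.2.1

theorem sum_bitProb (p : unitInterval) : ∑ b, bitProb p b = 1 := by
  simp [bitProb]

theorem sum_biUnion_cons (T : Bool → Finset (List Bool)) (F : List Bool → ℝ) :
    ∑ t ∈ univ.biUnion (fun b => (T b).image (List.cons b)), F t = ∑ b, ∑ t ∈ T b, F (b :: t) := by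
  rw [sum_biUnion]
  · exact sum_congr rfl fun b _ => sum_image fun _ _ _ _ h => (List.cons.inj h).2
  · intro b _ b' _ hbb'
    rw [Function.onFun, Finset.disjoint_left]
    intro t ht ht'
    obtain ⟨s, _, rfl⟩ := mem_image.1 ht
    obtain ⟨s', _, h⟩ := mem_image.1 ht'
    exact hbb' (List.cons.inj h).1.symm

namespace PrivateProtocol

section Transcript

variable {X Y Z : Type}

/-- The rectangle property: each message depends on one player's input only, given the transcript so
far. -/
theorem exists_transcriptProb_eq_mul (P : PrivateProtocol X Y Z) (t : List Bool) :
    ∃ (a : X → ℝ) (b : Y → ℝ), (∀ x, 0 ≤ a x) ∧ (∀ y, 0 ≤ b y) ∧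
      ∀ x y, P.transcriptProb (x, y) t = a x * b y := by
  induction P generalizing t with
  | output z =>
    cases t with
    | nil => exact ⟨1, 1, fun _ => zero_le_one, fun _ => zero_le_one, by simp [transcriptProb]⟩
    | cons c t => exact ⟨0, 0, fun _ => le_rfl, fun _ => le_rfl, by simp [transcriptProb]⟩
  | alice p next ih =>
    cases t with
    | nil => exact ⟨0, 0, fun _ => le_rfl, fun _ => le_rfl, by simp [transcriptProb]⟩
    | cons c t =>
      obtain ⟨a, b, ha, hb, h⟩ := ih c t
      exact ⟨fun x => bitProb (p x) c * a x, b,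
        fun x => mul_nonneg (bitProb_nonneg _ _) (ha x), hb, fun x y => by
          simp [transcriptProb, h, mul_assoc]⟩
  | bob p next ih =>
    cases t with
    | nil => exact ⟨0, 0, fun _ => le_rfl, fun _ => le_rfl, by simp [transcriptProb]⟩
    | cons c t =>
      obtain ⟨a, b, ha, hb, h⟩ := ih c t
      exact ⟨a, fun y => bitProb (p y) c * b y, ha,
        fun y => mul_nonneg (bitProb_nonneg _ _) (hb y), fun x y => by
          simp [transcriptProb, h, mul_left_comm]⟩

theorem transcriptProb_nonneg (P : PrivateProtocol X Y Z) (w : X × Y) (t : List Bool) :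
    0 ≤ P.transcriptProb w t := by
  obtain ⟨a, b, ha, hb, h⟩ := P.exists_transcriptProb_eq_mul t
  rw [show w = (w.1, w.2) from rfl, h]
  exact mul_nonneg (ha _) (hb _)

theorem sum_transcriptProb (P : PrivateProtocol X Y Z) (w : X × Y) :
    ∑ t ∈ P.transcripts, P.transcriptProb w t = 1 := by
  induction P with
  | output z => simp [transcripts, transcriptProb]
  | alice p next ih =>
    rw [transcripts, sum_biUnion_cons]
    simp only [transcriptProb, ← mul_sum, ih, mul_one, sum_bitProb]
  | bob p next ih =>
    rw [transcripts, sum_biUnion_cons]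
    simp only [transcriptProb, ← mul_sum, ih, mul_one, sum_bitProb]

theorem mul_transcriptProb_nonneg (P : PrivateProtocol X Y Z) (ρ : PMF (X × Y)) (w : X × Y)
    (t : List Bool) : 0 ≤ (ρ w).toReal * P.transcriptProb w t :=
  mul_nonneg ENNReal.toReal_nonneg (P.transcriptProb_nonneg w t)

end Transcript

section Cost

variable {X Y Z : Type} [Fintype X] [Fintype Y]

/-- The probability of a transcript. -/
def weight (P : PrivateProtocol X Y Z) (ρ : PMF (X × Y)) (t : List Bool) : ℝ :=
  ∑ w, (ρ w).toReal * P.transcriptProb w t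

/-- The contribution of a transcript to the information cost. -/
noncomputable def info (P : PrivateProtocol X Y Z) (ρ : PMF (X × Y)) (t : List Bool) : ℝ :=
  ∑ w, (ρ w).toReal * P.transcriptProb w t *
    Real.logb 2 ((ρ w).toReal * P.transcriptProb w t / ((ρ w).toReal * P.weight ρ t))

theorem mul_transcriptProb_le_weight (P : PrivateProtocol X Y Z) (ρ : PMF (X × Y)) (w : X × Y)
    (t : List Bool) : (ρ w).toReal * P.transcriptProb w t ≤ P.weight ρ t :=
  single_le_sum (f := fun w => (ρ w).toReal * P.transcriptProb w t)
    (fun w _ => P.mul_transcriptProb_nonneg ρ w t) (mem_univ w)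

theorem weight_nonneg (P : PrivateProtocol X Y Z) (ρ : PMF (X × Y)) (t : List Bool) :
    0 ≤ P.weight ρ t :=
  sum_nonneg fun w _ => P.mul_transcriptProb_nonneg ρ w t

theorem icost_eq_sum_info (P : PrivateProtocol X Y Z) (ρ : PMF (X × Y)) :
    P.icost ρ = ∑ t ∈ P.transcripts, P.info ρ t := by
  simp only [icost, mutualInfo, ← mul_sum, sum_transcriptProb, mul_one]
  exact sum_comm

/-- Gibbs' inequality: this is the weight of `t` times the relative entropy of the posterior given
`t` to the prior. -/
theorem info_nonneg (P : PrivateProtocol X Y Z) (ρ : PMF (X × Y)) (t : List Bool) :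
    0 ≤ P.info ρ t := by
  have h : ∀ w, ((ρ w).toReal * P.transcriptProb w t - (ρ w).toReal * P.weight ρ t) / Real.log 2 ≤
      (ρ w).toReal * P.transcriptProb w t *
      Real.logb 2 ((ρ w).toReal * P.transcriptProb w t / ((ρ w).toReal * P.weight ρ t)) := by
    intro w
    rw [Real.logb, ← mul_div_assoc]
    refine div_le_div_of_nonneg_right ?_ (Real.log_pos one_lt_two).le
    refine sub_le_mul_log_div (P.mul_transcriptProb_nonneg ρ w t)
      (mul_nonneg ENNReal.toReal_nonneg (P.weight_nonneg ρ t)) fun h => ?_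
    rcases mul_eq_zero.1 h with h | h
    · rw [h, zero_mul]
    · exact le_antisymm ((P.mul_transcriptProb_le_weight ρ w t).trans_eq h)
        (P.mul_transcriptProb_nonneg ρ w t)
  refine le_trans (le_of_eq ?_) (sum_le_sum fun w _ => h w)
  rw [← sum_div, sum_sub_distrib, ← sum_mul, sum_toReal, one_mul, ← weight, sub_self, zero_div]

theorem icost_nonneg (P : PrivateProtocol X Y Z) (ρ : PMF (X × Y)) : 0 ≤ P.icost ρ := by
  rw [icost_eq_sum_info]
  exact sum_nonneg fun t _ => P.info_nonneg ρ t

/-- A bound independent of the protocol, needed for summability over the public randomness. -/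
theorem icost_le_entropy (P : PrivateProtocol X Y Z) (ρ : PMF (X × Y)) :
    P.icost ρ ≤ ∑ w, (ρ w).toReal * Real.logb 2 (1 / (ρ w).toReal) := by
  have e : ∑ w, (ρ w).toReal * Real.logb 2 (1 / (ρ w).toReal) =
      ∑ t ∈ P.transcripts, ∑ w, (ρ w).toReal * P.transcriptProb w t *
        Real.logb 2 (1 / (ρ w).toReal) := by
    rw [sum_comm]
    refine sum_congr rfl fun w _ => ?_
    rw [← sum_mul, ← mul_sum, sum_transcriptProb, mul_one]
  rw [icost_eq_sum_info, e]
  refine sum_le_sum fun t _ => sum_le_sum fun w _ => ?_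
  rcases (P.mul_transcriptProb_nonneg ρ w t).eq_or_lt with h | h
  · rw [← h]; simp
  · refine mul_le_mul_of_nonneg_left ?_ h.le
    have h0 : 0 < (ρ w).toReal :=
      lt_of_le_of_ne ENNReal.toReal_nonneg fun h' => by rw [← h'] at h; simp at h
    have hq := P.mul_transcriptProb_le_weight ρ w t
    have hq0 := h.trans_le hq
    refine Real.logb_le_logb_of_le one_lt_two (div_pos h (mul_pos h0 hq0)) ?_
    rw [div_le_div_iff₀ (mul_pos h0 hq0) h0, one_mul, mul_comm]
    exact mul_le_mul_of_nonneg_left hq h0.le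

theorem error_nonneg (P : PrivateProtocol X Y Z) (ρ : PMF (X × Y)) (f : X × Y → Option Z) :
    0 ≤ P.error ρ f :=
  sum_nonneg fun w _ => sum_nonneg fun _ _ =>
    Set.indicator_nonneg (fun _ _ => P.mul_transcriptProb_nonneg ρ w _) _

theorem error_le_one (P : PrivateProtocol X Y Z) (ρ : PMF (X × Y)) (f : X × Y → Option Z) :
    P.error ρ f ≤ 1 := by
  calc P.error ρ f ≤ ∑ w, ∑ t ∈ P.transcripts, (ρ w).toReal * P.transcriptProb w t :=
        sum_le_sum fun w _ => sum_le_sum fun _ _ =>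
          Set.indicator_le_self' (fun _ _ => P.mul_transcriptProb_nonneg ρ w _) _
    _ = 1 := by simp only [← mul_sum, sum_transcriptProb, mul_one, sum_toReal]

theorem prob_eq_sum (P : PrivateProtocol X Y Z) (ρ : PMF (X × Y)) (E : Set (X × Y)) :
    prob ρ E = ∑ w, ∑ t ∈ P.transcripts, E.indicator 1 w *
      ((ρ w).toReal * P.transcriptProb w t) := by
  refine sum_congr rfl fun w _ => ?_
  rw [← mul_sum, ← mul_sum, sum_transcriptProb, mul_one]
  by_cases h : w ∈ E <;> simp [h]

/-- A transcript of small information and small error yields a large rectangle of small error. -/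
theorem exists_rectangle {ρ : PMF (X × Y)} {u : X → ℝ} {v : Y → ℝ}
    (hu : ∀ x, 0 ≤ u x) (hv : ∀ y, 0 ≤ v y) (hu1 : ∑ x, u x = 1) (hv1 : ∑ y, v y = 1)
    (hρ : ∀ x y, (ρ (x, y)).toReal = u x * v y) (P : PrivateProtocol X Y Z) (t : List Bool)
    (E : Set (X × Y)) {D ε : ℝ} (hε : 0 ≤ ε) (hq : 0 < P.weight ρ t)
    (hD : P.info ρ t ≤ D * P.weight ρ t)
    (hE : ∑ w, E.indicator 1 w * ((ρ w).toReal * P.transcriptProb w t) <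
      5 / 16 * ε * P.weight ρ t) :
    ∃ (A : Set X) (B : Set Y), prob ρ (A ×ˢ B \ Eᶜ) ≤ ε * prob ρ (A ×ˢ B) ∧
      (2 : ℝ) ^ (-(8 * (D + 1) + 2)) ≤ prob ρ (A ×ˢ B) := by
  obtain ⟨a, b, ha, hb, hab⟩ := P.exists_transcriptProb_eq_mul t
  obtain ⟨α, hα⟩ : ∃ α, α = ∑ x, u x * a x := ⟨_, rfl⟩
  obtain ⟨β, hβ⟩ : ∃ β, β = ∑ y, v y * b y := ⟨_, rfl⟩
  have hqαβ : P.weight ρ t = α * β := by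
    rw [weight, Fintype.sum_prod_type, hα, hβ, sum_mul_sum]
    exact sum_congr rfl fun x _ => sum_congr rfl fun y _ => by rw [hρ, hab]; ring
  have hα0 : 0 ≤ α := hα ▸ sum_nonneg fun x _ => mul_nonneg (hu x) (ha x)
  have hβ0 : 0 ≤ β := hβ ▸ sum_nonneg fun y _ => mul_nonneg (hv y) (hb y)
  rw [hqαβ] at hq hD hE
  have hα' : 0 < α := pos_of_mul_pos_left hq hβ0
  have hβ' : 0 < β := pos_of_mul_pos_right hq hα0
  have hh1 : ∑ x, u x * (a x / α) = 1 := by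
    simp only [← mul_div_assoc, ← sum_div]
    rw [← hα, div_self hα'.ne']
  have hk1 : ∑ y, v y * (b y / β) = 1 := by
    simp only [← mul_div_assoc, ← sum_div]
    rw [← hβ, div_self hβ'.ne']
  refine exists_rectangle_of_density hu hv hu1 hv1 hρ E (h := fun x => a x / α)
    (k := fun y => b y / β) (fun x => div_nonneg (ha x) hα0) (fun y => div_nonneg (hb y) hβ0)
    hh1 hk1 hε ?_ ?_
  · refine le_of_mul_le_mul_right ?_ hq
    refine le_trans (le_of_eq ?_) hD
    have e1 : ∑ x, u x * (a x / α * Real.logb 2 (a x / α)) =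
        ∑ x, ∑ y, (u x * (a x / α * Real.logb 2 (a x / α))) * (v y * (b y / β)) := by
      rw [← sum_mul_sum, hk1, mul_one]
    have e2 : ∑ y, v y * (b y / β * Real.logb 2 (b y / β)) =
        ∑ x, ∑ y, (u x * (a x / α)) * (v y * (b y / β * Real.logb 2 (b y / β))) := by
      rw [← sum_mul_sum, hh1, one_mul]
    rw [info, Fintype.sum_prod_type, e1, e2, ← sum_add_distrib, sum_mul]
    refine sum_congr rfl fun x _ => ?_
    rw [← sum_add_distrib, sum_mul]
    refine sum_congr rfl fun y _ => ?_
    rw [hρ, hab, hqαβ]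
    by_cases h0 : u x * v y * (a x * b y) = 0
    · rw [h0, zero_mul]
      simp only [mul_eq_zero] at h0
      rcases h0 with (h0 | h0) | h0 | h0 <;> simp [h0]
    · have hne := h0
      simp only [mul_eq_zero, not_or] at hne
      obtain ⟨⟨_, _⟩, h3, h4⟩ := hne
      rw [show u x * v y * (a x * b y) / (u x * v y * (α * β)) = (a x / α) * (b y / β) by
        field_simp, Real.logb_mul (div_ne_zero h3 hα'.ne') (div_ne_zero h4 hβ'.ne')]
      field_simp
  · refine lt_of_mul_lt_mul_right (lt_of_le_of_lt (le_of_eq ?_) hE) hq.le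
    rw [Fintype.sum_prod_type, sum_mul]
    refine sum_congr rfl fun x _ => ?_
    rw [sum_mul]
    refine sum_congr rfl fun y _ => ?_
    rw [hρ, hab]
    field_simp

/-- A protocol of small error and small information cost has a transcript with output `z` of small
error and small information. -/
theorem exists_transcript {ρ : PMF (X × Y)} (P : PrivateProtocol X Y Z) {f g : X × Y → Option Z}
    {z : Z} {θ L p : ℝ} (hθ : 0 < θ) (hL : 0 < L)
    (hfg : prob ρ {w | f w ≠ g w} ≤ θ) (hf : p ≤ prob ρ (f ⁻¹' {some z})) {κ : ℝ} (hκ : 0 ≤ κ)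
    (h : (P.error ρ f + θ) / (2 * θ) + P.icost ρ / L < κ * (p - P.error ρ f)) :
    ∃ t, 0 < P.weight ρ t ∧ P.info ρ t ≤ κ * L * P.weight ρ t ∧
      ∑ w, (g ⁻¹' {some z} ∪ g ⁻¹' {none})ᶜ.indicator 1 w *
        ((ρ w).toReal * P.transcriptProb w t) < 2 * κ * θ * P.weight ρ t := by
  classical
  obtain ⟨E, hE⟩ : ∃ E, E = (g ⁻¹' {some z} ∪ g ⁻¹' {none})ᶜ := ⟨_, rfl⟩
  rw [← hE]
  obtain ⟨e, he⟩ : ∃ e : List Bool → ℝ, e = fun t => ∑ w, E.indicator 1 w *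
      ((ρ w).toReal * P.transcriptProb w t) := ⟨_, rfl⟩
  have he0 : ∀ t, 0 ≤ e t := fun t => by
    rw [he]
    exact sum_nonneg fun w _ => mul_nonneg (Set.indicator_nonneg (fun _ _ => zero_le_one) _)
      (P.mul_transcriptProb_nonneg ρ w t)
  by_contra! hcon
  -- If no transcript is good, each has large error or large information; one inequality covers both
  -- cases and can be summed.
  have hbad : ∀ t, κ * P.weight ρ t ≤ e t / (2 * θ) + P.info ρ t / L := by
    intro t
    have hi := P.info_nonneg ρ t
    have h1 : 0 ≤ e t / (2 * θ) := div_nonneg (he0 t) (by linarith)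
    have h2 : 0 ≤ P.info ρ t / L := div_nonneg hi hL.le
    rcases (P.weight_nonneg ρ t).eq_or_lt with hw | hw
    · rw [← hw]; linarith
    · by_cases hc : P.info ρ t ≤ κ * L * P.weight ρ t
      · have h3 : κ * P.weight ρ t ≤ e t / (2 * θ) := by
          rw [le_div_iff₀ (by linarith), he]
          linarith [hcon t hw hc]
        linarith
      · have h3 : κ * P.weight ρ t ≤ P.info ρ t / L := by
          rw [le_div_iff₀ hL]
          linarith
        linarith
  set T := P.transcripts.filter fun t => P.out t = some z with hT
  -- If `z` is output while `g` takes a defined value other than `z`, then either `f` differs from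
  -- `g` there or the output is wrong for `f`.
  have hTerr : ∑ t ∈ T, e t ≤ P.error ρ f + prob ρ {w | f w ≠ g w} := by
    rw [P.prob_eq_sum, error, ← sum_add_distrib, he, sum_comm]
    refine sum_le_sum fun w _ => ?_
    rw [← sum_add_distrib, hT, sum_filter]
    refine sum_le_sum fun t _ => ?_
    have h0 := P.mul_transcriptProb_nonneg ρ w t
    by_cases h1 : P.out t = some z
    · rw [if_pos h1]
      by_cases h2 : w ∈ E
      · by_cases h3 : f w = g w
        · have h4 : f w ≠ none ∧ P.out t ≠ f w := by
            rw [hE] at h2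
            simp only [Set.mem_compl_iff, Set.mem_union, Set.mem_preimage, Set.mem_singleton_iff,
              not_or] at h2
            rw [h3, h1]
            exact ⟨h2.2, fun h => h2.1 h.symm⟩
          have h5 := Set.indicator_nonneg (s := {w | f w ≠ g w}) (f := (1 : X × Y → ℝ))
            (fun _ _ => zero_le_one) w
          rw [Set.indicator_of_mem h2,
            Set.indicator_of_mem (s := {t | f w ≠ none ∧ P.out t ≠ f w}) h4, Pi.one_apply, one_mul]
          exact le_add_of_nonneg_right (mul_nonneg h5 h0)
        · have := Set.indicator_nonneg (s := {t | f w ≠ none ∧ P.out t ≠ f w})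
            (fun t _ => P.mul_transcriptProb_nonneg ρ w t) t
          simpa [h2, h3] using this
      · have := Set.indicator_nonneg (s := {t | f w ≠ none ∧ P.out t ≠ f w})
          (fun t _ => P.mul_transcriptProb_nonneg ρ w t) t
        have h5 := Set.indicator_nonneg (s := {w | f w ≠ g w}) (f := (1 : X × Y → ℝ))
          (fun _ _ => zero_le_one) w
        simp only [Set.indicator_of_notMem h2, zero_mul]
        exact add_nonneg this (mul_nonneg h5 h0)
    · rw [if_neg h1]
      have := Set.indicator_nonneg (s := {t | f w ≠ none ∧ P.out t ≠ f w})
        (fun t _ => P.mul_transcriptProb_nonneg ρ w t) t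
      have h5 := Set.indicator_nonneg (s := {w | f w ≠ g w}) (f := (1 : X × Y → ℝ))
        (fun _ _ => zero_le_one) w
      exact add_nonneg this (mul_nonneg h5 h0)
  -- Where `f = z`, either the output is `z` or an error occurs.
  have hTw : prob ρ (f ⁻¹' {some z}) ≤ ∑ t ∈ T, P.weight ρ t + P.error ρ f := by
    simp only [weight]
    rw [P.prob_eq_sum, error, sum_comm (s := T), ← sum_add_distrib]
    refine sum_le_sum fun w _ => ?_
    rw [hT, sum_filter, ← sum_add_distrib]
    refine sum_le_sum fun t _ => ?_
    have h0 := P.mul_transcriptProb_nonneg ρ w t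
    have h6 := Set.indicator_nonneg (s := {t | f w ≠ none ∧ P.out t ≠ f w})
      (fun t _ => P.mul_transcriptProb_nonneg ρ w t) t
    by_cases h1 : P.out t = some z
    · rw [if_pos h1]
      by_cases h2 : f w = some z
      · simpa [h2] using h6
      · simpa [h2] using add_nonneg h0 h6
    · rw [if_neg h1]
      by_cases h2 : f w = some z
      · simp [h2, h1]
      · simpa [h2] using h6
  have hsum : κ * ∑ t ∈ T, P.weight ρ t ≤ (∑ t ∈ T, e t) / (2 * θ) + (∑ t ∈ T, P.info ρ t) / L := by
    rw [mul_sum, sum_div, sum_div, ← sum_add_distrib]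
    exact sum_le_sum fun t _ => hbad t
  have hinfo : (∑ t ∈ T, P.info ρ t) / L ≤ P.icost ρ / L := by
    rw [icost_eq_sum_info]
    exact div_le_div_of_nonneg_right
      (sum_le_sum_of_subset_of_nonneg (filter_subset _ _) fun t _ _ => P.info_nonneg ρ t) hL.le
  have herr : (∑ t ∈ T, e t) / (2 * θ) ≤ (P.error ρ f + θ) / (2 * θ) :=
    div_le_div_of_nonneg_right (by linarith) (by linarith)
  have := mul_le_mul_of_nonneg_left
    (by linarith : p - P.error ρ f ≤ ∑ t ∈ T, P.weight ρ t) hκ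
  linarith

end Cost

end PrivateProtocol

/-! ### The corruption bound and information cost -/

theorem summable_pmf_mul {R : Type} (ν : PMF R) {F : R → ℝ} {B : ℝ} (h0 : ∀ r, 0 ≤ F r)
    (hB : ∀ r, F r ≤ B) : Summable fun r => (ν r).toReal * F r :=
  Summable.of_nonneg_of_le (fun r => mul_nonneg ENNReal.toReal_nonneg (h0 r))
    (fun r => mul_le_mul_of_nonneg_left (hB r) ENNReal.toReal_nonneg)
    ((ENNReal.summable_toReal ν.tsum_coe_ne_top).mul_right B)

theorem exists_lt_of_tsum_pmf_lt {R : Type} (ν : PMF R) {F : R → ℝ} {c : ℝ}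
    (hF : Summable fun r => (ν r).toReal * F r) (h : ∑' r, (ν r).toReal * F r < c) :
    ∃ r, F r < c := by
  by_contra! hc
  have hs : Summable fun r => (ν r).toReal := ENNReal.summable_toReal ν.tsum_coe_ne_top
  have h1 : ∑' r, (ν r).toReal * c ≤ ∑' r, (ν r).toReal * F r :=
    (hs.mul_right c).tsum_le_tsum
      (fun r => mul_le_mul_of_nonneg_left (hc r) ENNReal.toReal_nonneg) hF
  rw [tsum_mul_right, ← ENNReal.tsum_toReal_eq ν.apply_ne_top, ν.tsum_coe, ENNReal.toReal_one,
    one_mul] at h1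
  linarith

section Main

variable {X Y Z : Type} [Fintype X] [Fintype Y]

theorem Protocol.icost_nonneg (P : Protocol X Y Z) (ρ : PMF (X × Y)) : 0 ≤ P.icost ρ :=
  tsum_nonneg fun r => mul_nonneg ENNReal.toReal_nonneg ((P.run r).icost_nonneg ρ)

theorem prob_le_errMono {ε : ℝ} {z : Z} {ρ : PMF (X × Y)} {f : X × Y → Option Z} {A : Set X}
    {B : Set Y} (h : IsErrMono ε z ρ f (A ×ˢ B)) : prob ρ (A ×ˢ B) ≤ errMono ε z ρ f := by
  refine le_csSup ⟨1, ?_⟩ ⟨A, B, h, rfl⟩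
  rintro _ ⟨A, B, _, rfl⟩
  exact prob_le_one ρ _

theorem errMono_le {ε : ℝ} {z : Z} {ρ : PMF (X × Y)} {f : X × Y → Option Z} {m : ℝ}
    (h : ∀ (A : Set X) (B : Set Y), IsErrMono ε z ρ f (A ×ˢ B) → prob ρ (A ×ˢ B) ≤ m) :
    errMono ε z ρ f ≤ m := by
  refine csSup_le ⟨_, ∅, ∅, by simp [IsErrMono, prob], rfl⟩ ?_
  rintro _ ⟨A, B, hAB, rfl⟩
  exact h A B hAB

theorem errMono_nonneg (ε : ℝ) (z : Z) (ρ : PMF (X × Y)) (f : X × Y → Option Z) :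
    0 ≤ errMono ε z ρ f :=
  (prob_nonneg ρ _).trans (prob_le_errMono (A := ∅) (B := ∅) (by simp [IsErrMono, prob]))

theorem errMono_le_one (ε : ℝ) (z : Z) (ρ : PMF (X × Y)) (f : X × Y → Option Z) :
    errMono ε z ρ f ≤ 1 :=
  errMono_le fun _ _ _ => prob_le_one ρ _

/-- Under a product distribution, the corruption bound of every perturbation of `f` is at most
linear in the information cost of a protocol of small error for `f`. -/
theorem rpow_le_errMono {ρ : PMF (X × Y)} {u : X → ℝ} {v : Y → ℝ}
    (hu : ∀ x, 0 ≤ u x) (hv : ∀ y, 0 ≤ v y) (hu1 : ∑ x, u x = 1) (hv1 : ∑ y, v y = 1)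
    (hρ : ∀ x y, (ρ (x, y)).toReal = u x * v y) {f g : X × Y → Option Z} {z : Z} {θ : ℝ}
    (hθ : 0 < θ) (hθ' : θ ≤ 1 / 1600) (hfg : prob ρ {w | f w ≠ g w} ≤ θ)
    (hf : 1 / 20 ≤ prob ρ (f ⁻¹' {some z})) (P : Protocol X Y Z) (hP : P.error ρ f ≤ θ) :
    (2 : ℝ) ^ (-(400 * P.icost ρ + 410)) ≤ errMono (400 * θ) z ρ g := by
  have hI := P.icost_nonneg ρ
  -- The summand `1` keeps `L` positive when the information cost vanishes.
  set L := P.icost ρ + 1 with hLdef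
  have hL : 0 < L := by linarith
  have hse : Summable fun r => (P.ν r).toReal * (P.run r).error ρ f :=
    summable_pmf_mul _ (fun r => (P.run r).error_nonneg ρ f) (fun r => (P.run r).error_le_one ρ f)
  have hsi : Summable fun r => (P.ν r).toReal * (P.run r).icost ρ :=
    summable_pmf_mul _ (fun r => (P.run r).icost_nonneg ρ)
      (fun r => (P.run r).icost_le_entropy ρ)
  have hsplit : (fun r => (P.ν r).toReal *
      ((P.run r).error ρ f * (1 / (2 * θ) + 50) + (P.run r).icost ρ * (1 / L))) =
      fun r => (P.ν r).toReal * (P.run r).error ρ f * (1 / (2 * θ) + 50) +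
        (P.ν r).toReal * (P.run r).icost ρ * (1 / L) := by
    funext r; ring
  -- A single functional controls error and information for the same `r`. Its mean is at most `1/2 +
  -- 50 θ + 1 < 2`, and `2 = 50 / 20 - 1/2` is what `exists_transcript` requires for `κ = 50`, `p =
  -- 1/20`.
  obtain ⟨r, hr⟩ := exists_lt_of_tsum_pmf_lt P.ν (c := 2)
    (F := fun r => (P.run r).error ρ f * (1 / (2 * θ) + 50) + (P.run r).icost ρ * (1 / L))
    (by rw [hsplit]; exact (hse.mul_right _).add (hsi.mul_right _)) (by
      rw [hsplit, (hse.mul_right _).tsum_add (hsi.mul_right _), tsum_mul_right, tsum_mul_right]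
      have h1 : P.error ρ f * (1 / (2 * θ) + 50) ≤ θ * (1 / (2 * θ) + 50) :=
        mul_le_mul_of_nonneg_right hP (by positivity)
      have h2 : θ * (1 / (2 * θ) + 50) = 1 / 2 + 50 * θ := by field_simp
      have h3 : P.icost ρ * (1 / L) ≤ 1 := by
        rw [mul_one_div, div_le_one hL]; linarith
      change P.error ρ f * (1 / (2 * θ) + 50) + P.icost ρ * (1 / L) < 2
      linarith)
  obtain ⟨t, hq, hinfo, herr⟩ := (P.run r).exists_transcript hθ hL hfg hf (κ := 50) (by norm_num)
    (by
      have e1 : ((P.run r).error ρ f + θ) / (2 * θ) = (P.run r).error ρ f * (1 / (2 * θ)) + 1 / 2 :=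
        by field_simp
      have e2 : (P.run r).icost ρ / L = (P.run r).icost ρ * (1 / L) := by rw [mul_one_div]
      rw [e1, e2]
      linarith)
  -- The transcript has conditional error below `100 θ ≤ 5/16 * (400 θ)`. With `D = 50 L` the
  -- exponent `8 (D + 1) + 2` equals `400 L + 10`.
  obtain ⟨A, B, hAB, hpr⟩ := (P.run r).exists_rectangle hu hv hu1 hv1 hρ t
    (g ⁻¹' {some z} ∪ g ⁻¹' {none})ᶜ (ε := 400 * θ) (by positivity) hq hinfo
    (herr.trans_le (mul_le_mul_of_nonneg_right (by linarith) hq.le))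
  rw [compl_compl] at hAB
  refine le_trans ?_ (prob_le_errMono hAB)
  refine le_trans (le_of_eq ?_) hpr
  congr 1
  rw [hLdef]; ring

end Main

end InfoCorruption

namespace InfoCorruption

/-! ### From Gap-Hamming to orthogonality -/

open Classical in
/-- Gap-Hamming with the value `-1` in place of `1` where the inner product exceeds `s`. -/
noncomputable def cappedGHD (n : ℕ) (s : ℝ) (w : Cube n × Cube n) : Option ℤˣ :=
  if s < ip w.1 w.2 then some (-1) else GHD n w

theorem prob_GHD_ne_cappedGHD_le {n : ℕ} {t : ℝ} (ht : 0 ≤ t) :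
    prob (unif n) {w | GHD n w ≠ cappedGHD n (t * √n + 4) w} ≤ tail t := by
  refine (prob_mono _ fun w hw => ?_).trans (prob_lt_ip_le_tail ht)
  by_contra h
  exact hw (if_neg h).symm

/-- Undefined points count as error-free in a rectangle, so they have to be confined as well; those
of Gap-Hamming satisfy `|⟨x, y⟩| < √n`. -/
theorem ip_mem_of_cappedGHD {n : ℕ} {s : ℝ} {w : Cube n × Cube n}
    (h : w ∈ cappedGHD n s ⁻¹' {some 1} ∪ cappedGHD n s ⁻¹' {none}) :
    -√n < ip w.1 w.2 ∧ ip w.1 w.2 ≤ s := by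
  have hne : cappedGHD n s w ≠ some (-1) := by
    rcases h with h | h <;> rw [Set.mem_preimage, Set.mem_singleton_iff] at h <;> rw [h] <;> decide
  constructor
  · by_contra! hle
    refine hne ?_
    rw [cappedGHD, GHD, if_pos hle, ite_self]
  · by_contra! hlt
    exact hne (if_pos hlt)

/-- The pair `(x, y)` extended by `k` coordinates with product `-1`. -/
def pad {n : ℕ} (k : ℕ) : Cube n × Cube n → Cube (n + k) × Cube (n + k) :=
  Prod.map (fun x => Fin.append x 1) fun y => Fin.append y (-1)

theorem pad_injective {n k : ℕ} : Function.Injective (pad k : Cube n × Cube n → _) := by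
  refine Function.Injective.prodMap ?_ ?_ <;>
  · intro x y h
    funext i
    simpa using congrFun h (Fin.castAdd k i)

theorem ip_pad {n k : ℕ} (w : Cube n × Cube n) :
    ip (pad k w).1 (pad k w).2 = ip w.1 w.2 - k := by
  simp [ip, pad, Fin.sum_univ_add, sub_eq_add_neg]

theorem prob_image_pad {n k : ℕ} (E : Set (Cube n × Cube n)) :
    prob (unif n) E = 4 ^ k * prob (unif (n + k)) (pad k '' E) := by
  rw [unif, unif, prob_eq_ncard_div, prob_eq_ncard_div, Set.ncard_image_of_injective _ pad_injective,
    Fintype.card_prod, Fintype.card_prod, card_cube, card_cube]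
  have : (4 : ℝ) ^ k = 2 ^ k * 2 ^ k := by rw [← mul_pow]; norm_num
  rw [this]
  push_cast
  rw [pow_add]
  field_simp

theorem errMono_le_errMono_ORT {n k : ℕ} {b ε : ℝ} {g : Cube n × Cube n → Option ℤˣ}
    (hg : ∀ w ∈ g ⁻¹' {some 1} ∪ g ⁻¹' {none}, |ip w.1 w.2 - k| ≤ b * √((n + k : ℕ) : ℝ)) :
    errMono ε 1 (unif n) g ≤ 4 ^ k * errMono ε 1 (unif (n + k)) (ORT b (n + k)) := by
  refine errMono_le fun A B hAB => ?_
  have himg : pad k '' (A ×ˢ B) =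
      ((fun x => Fin.append x 1) '' A) ×ˢ ((fun y => Fin.append y (-1)) '' B) :=
    Set.prodMap_image_prod _ _ _ _
  rw [prob_image_pad (k := k)]
  refine mul_le_mul_of_nonneg_left ?_ (by positivity)
  rw [himg]
  refine prob_le_errMono ?_
  rw [← himg]
  unfold IsErrMono at hAB ⊢
  -- Both sides scale by the same `4 ^ k`, which cancels.
  rw [prob_image_pad (k := k), prob_image_pad (k := k) (A ×ˢ B), mul_left_comm] at hAB
  refine (prob_mono _ ?_).trans (le_of_mul_le_mul_left hAB (by positivity))
  rintro _ ⟨⟨w, hw, rfl⟩, hbad⟩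
  refine ⟨w, ⟨hw, fun hgood => hbad (Or.inl ?_)⟩, rfl⟩
  have := hg w hgood
  rw [← ip_pad] at this
  exact if_pos this

/-- The centred half-width is `(1.99 b + 1) / 2 * √n` up to an additive `5`, and `(1.99 b + 1) / 2 ≤
b` is exactly `b ≥ 100`. -/
theorem abs_sub_le_mul_sqrt {n k : ℕ} {b s : ℝ} (hn : 1 ≤ n) (hb : 100 ≤ b)
    (hk : |(k : ℝ) - 1 / 2 * (1.99 * b - 1) * √n| < 1) (h1 : -√n < s)
    (h2 : s ≤ 1.99 * b * √n + 4) : |s - k| ≤ b * √((n + k : ℕ) : ℝ) := by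
  have hn' : (1 : ℝ) ≤ n := by exact_mod_cast hn
  have hs : 1 ≤ √(n : ℝ) := Real.one_le_sqrt.2 hn'
  have hss := Real.sq_sqrt (by linarith : (0 : ℝ) ≤ n)
  set r := √(n : ℝ)
  rw [abs_lt] at hk
  have hbr : 100 * r ≤ b * r := mul_le_mul_of_nonneg_right hb (by linarith)
  -- The additive `5` is absorbed by the greater length: `k ≥ 49 √n` gives `√(n + k) ≥ √n + 5 / b`.
  have hroot : b * r + 5 ≤ b * √((n + k : ℕ) : ℝ) := by
    have hk1 : 49 * r ≤ k := by linarith [hk.1]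
    have : r + 5 / b ≤ √((n + k : ℕ) : ℝ) := by
      refine Real.le_sqrt_of_sq_le ?_
      have h5 : 5 / b ≤ 1 := by rw [div_le_one (by linarith)]; linarith
      have h50 : 0 ≤ 5 / b := by positivity
      push_cast
      nlinarith
    calc b * r + 5 = b * (r + 5 / b) := by field_simp
      _ ≤ _ := mul_le_mul_of_nonneg_left this (by linarith)
  refine (abs_le.2 ⟨?_, ?_⟩ : |s - k| ≤ b * r + 5).trans hroot
  · linarith [hk.2]
  · linarith [hk.1]

theorem cb_eq_of_pos {X Y Z : Type} [Fintype X] [Fintype Y] {z : Z} {ρ : PMF (X × Y)} {ε : ℝ}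
    {f : X × Y → Option Z} (h : 0 < errMono ε z ρ f) :
    cb z ρ ε f = ((-Real.logb 2 (errMono ε z ρ f) : ℝ) : EReal) :=
  if_neg h.ne'

theorem unif_apply_toReal {n : ℕ} (x y : Cube n) :
    (unif n (x, y)).toReal = (2 ^ n)⁻¹ * (2 ^ n)⁻¹ := by
  simp [unif]

theorem neg_logb_errMono_ORT_le {n k : ℕ} {b ε : ℝ} {g : Cube n × Cube n → Option ℤˣ}
    (h0 : 0 < errMono ε 1 (unif n) g)
    (h : errMono ε 1 (unif n) g ≤ 4 ^ k * errMono ε 1 (unif (n + k)) (ORT b (n + k))) :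
    0 < errMono ε 1 (unif (n + k)) (ORT b (n + k)) ∧
      -Real.logb 2 (errMono ε 1 (unif (n + k)) (ORT b (n + k))) ≤
        -Real.logb 2 (errMono ε 1 (unif n) g) + 2 * k := by
  have hpos : 0 < errMono ε 1 (unif (n + k)) (ORT b (n + k)) :=
    pos_of_mul_pos_right (h0.trans_le h) (by positivity)
  refine ⟨hpos, ?_⟩
  have := Real.logb_le_logb_of_le one_lt_two h0 h
  rw [Real.logb_mul (by positivity) hpos.ne', Real.logb_pow, show (4 : ℝ) = 2 ^ 2 by norm_num,
    Real.logb_pow, Real.logb_self_eq_one one_lt_two] at this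
  push_cast at this
  linarith

end InfoCorruption

theorem theorem4p3 :
    ∃ c : ℝ, 0 < c ∧ ∀ b : ℝ, 100 ≤ b → ∃ (C : ℝ) (n₀ : ℕ), ∀ n : ℕ, n₀ ≤ n →
      ∀ θ : ℝ, InfoCorruption.tail (1.99 * b) ≤ θ → θ ≤ 1 / 1600 →
      ∀ n' : ℕ, |(n' : ℝ) - ((n : ℝ) + 1 / 2 * (1.99 * b - 1) * √(n : ℝ))| < 1 →
        (c : EReal) * InfoCorruption.cb 1 (InfoCorruption.unif n') (400 * θ)
              (InfoCorruption.ORT b n') - ((C * √(n : ℝ) : ℝ) : EReal)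
            ≤ InfoCorruption.scb 1 (InfoCorruption.unif n) (400 * θ) θ (InfoCorruption.GHD n) ∧
        (c : EReal) * InfoCorruption.cb 1 (InfoCorruption.unif n') (400 * θ)
              (InfoCorruption.ORT b n') - ((C * √(n : ℝ) : ℝ) : EReal)
            ≤ InfoCorruption.IC (InfoCorruption.unif n) θ (InfoCorruption.GHD n) := by
  open InfoCorruption in
  -- `1 / 400` inverts the slope in `rpow_le_errMono`. In `C`, `b` covers the padding loss `2k /
  -- 400` and `2` covers `410 / 400`.
  refine ⟨1 / 400, by norm_num, fun b hb => ⟨b + 2, 100, fun n hn θ hθ hθ' n' hn' => ?_⟩⟩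
  have hnR : (100 : ℝ) ≤ n := by exact_mod_cast hn
  have hs : 10 ≤ √(n : ℝ) := Real.le_sqrt_of_sq_le (by linarith)
  have hbs : 100 * √(n : ℝ) ≤ b * √n := mul_le_mul_of_nonneg_right hb (by linarith)
  have hle : n ≤ n' := by
    have : (n : ℝ) ≤ n' := by
      rw [abs_lt] at hn'
      linarith [hn'.1]
    exact_mod_cast this
  obtain ⟨k, rfl⟩ := Nat.exists_eq_add_of_le hle
  have hk : |(k : ℝ) - 1 / 2 * (1.99 * b - 1) * √n| < 1 := by
    refine lt_of_eq_of_lt ?_ hn'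
    congr 1
    push_cast
    ring
  have hkC : 2 * (k : ℝ) ≤ 2 * (b * √n) := by
    rw [abs_lt] at hk
    linarith [hk.2]
  set g := cappedGHD n (1.99 * b * √n + 4)
  have hfg : prob (unif n) {w | GHD n w ≠ g w} ≤ θ :=
    (prob_GHD_ne_cappedGHD_le (by linarith)).trans hθ
  have hθ0 : 0 < θ := (tail_pos (by linarith)).trans_le hθ
  have hpad : errMono (400 * θ) 1 (unif n) g ≤
      4 ^ k * errMono (400 * θ) 1 (unif (n + k)) (ORT b (n + k)) :=
    errMono_le_errMono_ORT fun w hw =>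
      abs_sub_le_mul_sqrt (by omega) hb hk (ip_mem_of_cappedGHD hw).1 (ip_mem_of_cappedGHD hw).2
  have hscb : cb 1 (unif n) (400 * θ) g ≤ scb 1 (unif n) (400 * θ) θ (GHD n) :=
    le_iSup₂_of_le g hfg le_rfl
  constructor
  · refine le_trans ?_ hscb
    rcases (errMono_nonneg (400 * θ) 1 (unif n) g).eq_or_lt with h0 | h0
    · rw [cb, cb, if_pos h0.symm]
      exact le_top
    obtain ⟨hpos, hlog⟩ := neg_logb_errMono_ORT_le h0 hpad
    -- Nonnegativity of the corruption bound of `g` permits its replacement by a `1 / 400` fraction.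
    have := Real.logb_nonpos one_lt_two h0.le (errMono_le_one (400 * θ) 1 (unif n) g)
    rw [cb_eq_of_pos h0, cb_eq_of_pos hpos, ← EReal.coe_mul, ← EReal.coe_sub, EReal.coe_le_coe_iff]
    linarith
  · refine le_iInf₂ fun P hP => ?_
    have hsum : ∑ _x : Cube n, ((2 : ℝ) ^ n)⁻¹ = 1 := by simp
    have hlow := rpow_le_errMono (u := fun _ => (2 ^ n)⁻¹) (v := fun _ => (2 ^ n)⁻¹)
      (fun _ => by positivity) (fun _ => by positivity) hsum hsum unif_apply_toReal hθ0 hθ' hfg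
      (prob_GHD_one_ge hn) P hP
    have h0 : 0 < errMono (400 * θ) 1 (unif n) g := lt_of_lt_of_le (by positivity) hlow
    obtain ⟨hpos, hlog⟩ := neg_logb_errMono_ORT_le h0 hpad
    have hlow' := (Real.le_logb_iff_rpow_le one_lt_two h0).2 hlow
    rw [cb_eq_of_pos hpos, ← EReal.coe_mul, ← EReal.coe_sub, EReal.coe_le_coe_iff]
    linarith
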